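/- **Setting.** A $\mu$-component *virtual link diagram* is the image of an immersion of $\mu$ ordered and oriented circles in the plane whose only singularities are transverse double points, each marked either as a classical crossing (with over/under information) or as a virtual crossing. Diagrams are considered up to planar isotopy. A *local move* replaces the part of a diagram inside a disk; the strands may have arbitrary orientations unless these are specified. Moves may be applied in both directions. A *realization* of a local move by other moves means that any two diagrams that differ by one application of the move are related by a finite sequence of the other moves. The *welded Reidemeister moves* are the classical Reidemeister moves R1, R2, R3; the virtual moves VR1, VR2, VR3 (the same moves with all crossings virtual) and VR4 (a strand having only virtual crossings with two other strands is moved across a classical crossing of these two); and the OC-move (a strand passing over two other strands is moved across a virtual crossing of these two). The *UC-move* moves a strand passing under two other strands across a virtual crossing of these two. For a positive integer $n$, the *$V^n$-move* replaces two parallel strands without crossings, oriented in the same direction, by the following two-strand diagram: with both strands oriented upwards, it is the vertical composition of $n$ copies of the diagram which, read upwards, consists of a virtual crossing followed by a positive classical crossing. (Thus the strand starting on the right passes over the other one in all $n$ classical crossings.) **Corollary.** Let $n$ be a positive integer. Every UC-move is realized by a finite sequence of $V^n$-moves and welded Reidemeister moves if and only if $n=1$. -/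

import Mathlib

/-!
Virtual link diagrams in the plane, welded Reidemeister moves, UC-moves and V^n-moves.

A diagram is drawn in general position with respect to the height function and is cut by
horizontal lines into layers, each containing exactly one of: a crossing, a local minimum (cup),
a local maximum (cap), next to vertical strands. Diagrams are read from bottom to top. Planar
isotopy is generated by the elementary moves between such sliced diagrams.
-/

namespace WeldedLink

/-- A point of the diagram on a horizontal line: the direction of the strand through it
(`up = true` if it runs upwards) and the label of the component of the link it lies on. -/
structure Strand (ι : Type) where
  up : Bool
  label : ι

/-- The same component, traversed in the opposite vertical direction. -/
def Strand.rev {ι : Type} (s : Strand ι) : Strand ι := ⟨!s.up, s.label⟩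

/-- Types of crossings. For a crossing of two strands, read from bottom to top:
`over`: classical, the strand coming from the bottom left passes over the other one;
`under`: classical, the strand coming from the bottom left passes under the other one;
`virt`: a virtual crossing. -/
inductive Kind
  | over
  | under
  | virt

/-- Exchange the roles of the two strands in the description of a crossing. -/
def Kind.flip : Kind → Kind
  | .over => .under
  | .under => .over
  | .virt => .virt

/-- Elementary pieces. `cross k s t` is a crossing of kind `k` where `s` enters at the bottom left
(and leaves at the top right) and `t` enters at the bottom right (and leaves at the top left).
`cup s` is a local minimum whose left end is `s`; `cap s` is a local maximum whose
left end is `s`. -/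
inductive Piece (ι : Type)
  | cross (k : Kind) (s t : Strand ι)
  | cup (s : Strand ι)
  | cap (s : Strand ι)

/-- The bottom boundary of a piece, from left to right. -/
def Piece.src {ι : Type} : Piece ι → List (Strand ι)
  | .cross _ s t => [s, t]
  | .cup _ => []
  | .cap s => [s, s.rev]

/-- The top boundary of a piece, from left to right. -/
def Piece.tgt {ι : Type} : Piece ι → List (Strand ι)
  | .cross _ s t => [t, s]
  | .cup s => [s, s.rev]
  | .cap _ => []

/-- A layer: one piece with vertical strands to its left and to its right. -/
structure Layer (ι : Type) where
  left : List (Strand ι)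
  piece : Piece ι
  right : List (Strand ι)

def Layer.src {ι : Type} (l : Layer ι) : List (Strand ι) := l.left ++ l.piece.src ++ l.right

def Layer.tgt {ι : Type} (l : Layer ι) : List (Strand ι) := l.left ++ l.piece.tgt ++ l.right

/-- A stack of layers, listed from bottom to top. -/
abbrev Word (ι : Type) := List (Layer ι)

/-- `IsTangle a w b`: the layers of `w` fit together to a (virtual) tangle diagram with bottom
boundary `a` and top boundary `b`; in particular directions and labels agree along strands. -/
def IsTangle {ι : Type} : List (Strand ι) → Word ι → List (Strand ι) → Prop
  | a, [], b => a = b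
  | a, l :: w, b => l.src = a ∧ IsTangle l.tgt w b

/-- Add vertical strands `L` on the left and `R` on the right. -/
def whisker {ι : Type} (L : List (Strand ι)) (w : Word ι) (R : List (Strand ι)) : Word ι :=
  w.map fun l => ⟨L ++ l.left, l.piece, l.right ++ R⟩

/-- A closed diagram: an oriented virtual link diagram whose circles are labelled by elements of
`ι`, each circle having one label. -/
abbrev ClosedDiagram (ι : Type) := {w : Word ι // IsTangle [] w []}

/-! ### Ordered link diagrams -/

/-- The sequence of strands of a closed diagram at height `i` (below the `i`-th layer). -/
def level {ι : Type} (w : Word ι) : ℕ → List (Strand ι)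
  | 0 => []
  | i + 1 => match w[i]? with
    | some l => l.tgt
    | none => []

/-- `Joined w p q`: the points `p` and `q`, each given as (height, position from the left,
starting with 0), are joined by an arc of the diagram within one layer. -/
inductive Joined {ι : Type} (w : Word ι) : ℕ × ℕ → ℕ × ℕ → Prop
  | left {i j : ℕ} {l : Layer ι} (h : w[i]? = some l) (hj : j < l.left.length) :
      Joined w (i, j) (i + 1, j)
  | right {i j : ℕ} {l : Layer ι} (h : w[i]? = some l) (hj : j < l.right.length) :
      Joined w (i, l.left.length + l.piece.src.length + j)
        (i + 1, l.left.length + l.piece.tgt.length + j)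
  | cross_fst {i : ℕ} {A B : List (Strand ι)} {k : Kind} {s t : Strand ι}
      (h : w[i]? = some ⟨A, .cross k s t, B⟩) : Joined w (i, A.length) (i + 1, A.length + 1)
  | cross_snd {i : ℕ} {A B : List (Strand ι)} {k : Kind} {s t : Strand ι}
      (h : w[i]? = some ⟨A, .cross k s t, B⟩) : Joined w (i, A.length + 1) (i + 1, A.length)
  | cup {i : ℕ} {A B : List (Strand ι)} {s : Strand ι}
      (h : w[i]? = some ⟨A, .cup s, B⟩) : Joined w (i + 1, A.length) (i + 1, A.length + 1)
  | cap {i : ℕ} {A B : List (Strand ι)} {s : Strand ι}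
      (h : w[i]? = some ⟨A, .cap s, B⟩) : Joined w (i, A.length) (i, A.length + 1)

/-- The point `p` belongs to the diagram and carries the label `c`. -/
def HasLabel {ι : Type} (w : Word ι) (p : ℕ × ℕ) (c : ι) : Prop :=
  ∃ b : Bool, (level w p.1)[p.2]? = some ⟨b, c⟩

/-- A `μ`-component virtual link diagram, oriented and ordered: a closed diagram with labels
in `Fin μ` in which the points with a given label form exactly one circle. -/
structure LinkDiagram (μ : ℕ) where
  diagram : ClosedDiagram (Fin μ)
  nonempty : ∀ c : Fin μ, ∃ p, HasLabel diagram.1 p c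
  connected : ∀ (c : Fin μ) (p q : ℕ × ℕ), HasLabel diagram.1 p c → HasLabel diagram.1 q c →
    Relation.EqvGen (Joined diagram.1) p q

/-! ### Local moves

A local move is given by the two tangle diagrams in the disk where it takes place. All strands
`s`, `t`, `u` below may have arbitrary directions and labels, unless a direction is prescribed. -/

/-- Elementary planar isotopies of sliced diagrams. -/
inductive PlanarMove {ι : Type} : Word ι → Word ι → Prop
  /-- Two pieces that are side by side exchange their heights. -/
  | exchange (g h : Piece ι) (M : List (Strand ι)) :
      PlanarMove [⟨[], g, M ++ h.src⟩, ⟨g.tgt ++ M, h, []⟩]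
        [⟨g.src ++ M, h, []⟩, ⟨[], g, M ++ h.tgt⟩]
  /-- A minimum and a maximum cancel. -/
  | zigzag_left (s : Strand ι) :
      PlanarMove [⟨[], .cup s, [s]⟩, ⟨[s], .cap s.rev, []⟩] []
  | zigzag_right (s : Strand ι) :
      PlanarMove [⟨[s], .cup s.rev, []⟩, ⟨[], .cap s, [s]⟩] []
  /-- A crossing passes a maximum, from its right leg to its left leg. -/
  | slide_cap (k : Kind) (s t : Strand ι) :
      PlanarMove [⟨[s], .cross k t s.rev, []⟩, ⟨[], .cap s, [t]⟩]
        [⟨[], .cross k.flip s t, [s.rev]⟩, ⟨[t], .cap s, []⟩]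
  /-- A crossing passes a minimum, from its right leg to its left leg. -/
  | slide_cup (k : Kind) (s t : Strand ι) :
      PlanarMove [⟨[], .cup s, [t]⟩, ⟨[s], .cross k s.rev t, []⟩]
        [⟨[t], .cup s, []⟩, ⟨[], .cross k.flip t s, [s.rev]⟩]

/-- Three strands `s`, `t`, `u` (from left to right at the bottom) cross pairwise, `s` and `t`
cross first; the kinds of the crossings of `s, t`, of `s, u` and of `t, u` are `a`, `b`, `c`,
described from the first strand of each pair. -/
def triangleLeft {ι : Type} (a b c : Kind) (s t u : Strand ι) : Word ι :=
  [⟨[], .cross a s t, [u]⟩, ⟨[t], .cross b s u, []⟩, ⟨[], .cross c t u, [s]⟩]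

/-- As `triangleLeft`, but `t` and `u` cross first. -/
def triangleRight {ι : Type} (a b c : Kind) (s t u : Strand ι) : Word ι :=
  [⟨[s], .cross c t u, []⟩, ⟨[], .cross b s u, [t]⟩, ⟨[u], .cross a s t, []⟩]

/-- Kinds of the three crossings in a third classical Reidemeister move: all are classical, and
the three strands lie at different heights, i.e. the relation "passes over" is not cyclic. -/
def IsR3 (a b c : Kind) : Prop :=
  a ≠ .virt ∧ b ≠ .virt ∧ c ≠ .virt ∧ (a = c → b = a)

/-- Kinds of the crossings in VR3 and VR4: one strand has only virtual crossings with the other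
two; those cross virtually in VR3 and classically in VR4. -/
inductive IsVR34 : Kind → Kind → Kind → Prop
  | fst (k : Kind) : IsVR34 .virt .virt k
  | snd (k : Kind) : IsVR34 .virt k .virt
  | thd (k : Kind) : IsVR34 k .virt .virt

/-- Kinds of the crossings in the OC-move (over-crossings commute): one strand passes over the
other two, which cross virtually. -/
inductive IsOC : Kind → Kind → Kind → Prop
  | fst : IsOC .over .over .virt
  | snd : IsOC .under .virt .over
  | thd : IsOC .virt .under .under

/-- Kinds of the crossings in the UC-move (under-crossings commute): one strand passes under the
other two, which cross virtually. -/
inductive IsUC : Kind → Kind → Kind → Prop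
  | fst : IsUC .under .under .virt
  | snd : IsUC .over .virt .under
  | thd : IsUC .virt .over .over

/-- The welded Reidemeister moves: R1, R2, R3, VR1, VR2, VR3, VR4 and OC. -/
inductive ReidemeisterMove {ι : Type} : Word ι → Word ι → Prop
  /-- R1 (`k` classical) and VR1 (`k` virtual), the loop lying to the right of the strand. -/
  | one_right (k : Kind) (s : Strand ι) :
      ReidemeisterMove [⟨[s], .cup s, []⟩, ⟨[], .cross k s s, [s.rev]⟩, ⟨[s], .cap s, []⟩] []
  /-- R1 and VR1, the loop lying to the left of the strand. -/
  | one_left (k : Kind) (s : Strand ι) :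
      ReidemeisterMove
        [⟨[], .cup s.rev, [s]⟩, ⟨[s.rev], .cross k s s, []⟩, ⟨[], .cap s.rev, [s]⟩] []
  /-- R2 (`k` classical) and VR2 (`k` virtual). -/
  | two (k : Kind) (s t : Strand ι) :
      ReidemeisterMove [⟨[], .cross k s t, []⟩, ⟨[], .cross k.flip t s, []⟩] []
  /-- R3. -/
  | three (a b c : Kind) (h : IsR3 a b c) (s t u : Strand ι) :
      ReidemeisterMove (triangleLeft a b c s t u) (triangleRight a b c s t u)
  /-- VR3 and VR4. -/
  | virtual_three (a b c : Kind) (h : IsVR34 a b c) (s t u : Strand ι) :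
      ReidemeisterMove (triangleLeft a b c s t u) (triangleRight a b c s t u)
  /-- OC. -/
  | overcrossings (a b c : Kind) (h : IsOC a b c) (s t u : Strand ι) :
      ReidemeisterMove (triangleLeft a b c s t u) (triangleRight a b c s t u)

/-- The UC-move. -/
inductive UCMove {ι : Type} : Word ι → Word ι → Prop
  | undercrossings (a b c : Kind) (h : IsUC a b c) (s t u : Strand ι) :
      UCMove (triangleLeft a b c s t u) (triangleRight a b c s t u)

/-- `n` times in a row: a virtual crossing followed by a classical crossing of two strands,
where `t` passes over `s` in each classical crossing. -/
def virtualTwist {ι : Type} (n : ℕ) (s t : Strand ι) : Word ι :=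
  (List.replicate n [⟨[], .cross .virt s t, []⟩, ⟨[], .cross .over t s, []⟩]).flatten

/-- The `V^n`-move: two parallel strands, oriented in the same direction (upwards), are replaced
by `n` pairs consisting of a virtual crossing followed by a positive classical crossing. -/
inductive VMove {ι : Type} (n : ℕ) : Word ι → Word ι → Prop
  | mk (c d : ι) : VMove n [] (virtualTwist n ⟨true, c⟩ ⟨true, d⟩)

/-- `Step M D D'`: `D'` arises from `D` by applying the local move `M` once, in some disk. -/
inductive Step {ι : Type} (M : Word ι → Word ι → Prop) : ClosedDiagram ι → ClosedDiagram ι → Prop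
  | mk (D D' : ClosedDiagram ι) (w₁ w₂ m m' : Word ι) (L R : List (Strand ι)) (hm : M m m')
      (hD : D.1 = w₁ ++ whisker L m R ++ w₂) (hD' : D'.1 = w₁ ++ whisker L m' R ++ w₂) :
      Step M D D'

/-- `D` and `D'` are related by planar isotopy, welded Reidemeister moves and `V^n`-moves (all of
them in both directions). The moves preserve the circles of a diagram and their labels. -/
def VEquiv {ι : Type} (n : ℕ) : ClosedDiagram ι → ClosedDiagram ι → Prop :=
  Relation.EqvGen fun D D' =>
    Step PlanarMove D D' ∨ Step ReidemeisterMove D D' ∨ Step (VMove n) D D'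

/-- The UC-move is realized by a sequence of `V^n`-moves and welded Reidemeister moves: any two
virtual link diagrams that differ by one UC-move are related by such a sequence. -/
def UCRealizedByV (n : ℕ) : Prop :=
  ∀ (μ : ℕ) (D D' : LinkDiagram μ),
    Step UCMove D.diagram D'.diagram → VEquiv n D.diagram D'.diagram

end WeldedLink

/-! Case `n = 1`. The `V^1`-move makes a virtual crossing followed by a positive classical crossing
trivial. Combined with VR2, this lets a positive crossing of two upward strands be replaced by a
virtual one; R2 gives the negative crossing, and rotating the crossing gives all other directions
(`virtualizable`). Both sides of a UC-move then become triangles of virtual crossings, which VR3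
identifies (`tangleEquiv_triangle`).

Case `n ≠ 1`. The obstruction is colourability by a quandle in which each component may only use
colours carrying its own label; without labels, constant colourings would always exist. A colour
changes only where a strand passes under another one, so colourability is invariant under the welded
moves, and also under the `V^n`-move if the action of every colour has `n`-th power 1
(`VEquiv.wordRel_iff`). The UC-move, by contrast, interchanges two successive actions on the lower
strand, and these need not commute.

In the quandle `HeisenbergColor n`, the colours of components 1 and 2 act on those of component 0 by
permutations whose `n`-th powers are trivial, but whose commutator is a translation by `±1` in `ZMod
n`. One UC-move turns `commutatorLink`, where the colour of component 0 would have to be fixed by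
such a commutator, into `trivialLink`, which is colourable. The former is colourable only if `1 = 0`
in `ZMod n`. -/

namespace WeldedLink

/-! ### Calculus of tangle diagrams, and the case `n = 1`. -/

section Tangles

variable {ι : Type}

theorem isTangle_append {a c : List (Strand ι)} {v w : Word ι} :
    IsTangle a (v ++ w) c ↔ ∃ b, IsTangle a v b ∧ IsTangle b w c := by
  induction v generalizing a with
  | nil => simp [IsTangle]
  | cons l v ih => simp [IsTangle, ih, and_assoc]

theorem IsTangle.whisker {a b : List (Strand ι)} {w : Word ι} (h : IsTangle a w b)
    (L R : List (Strand ι)) : IsTangle (L ++ a ++ R) (whisker L w R) (L ++ b ++ R) := by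
  induction w generalizing a with
  | nil => simp_all [IsTangle, WeldedLink.whisker]
  | cons l w ih =>
    obtain ⟨rfl, h⟩ := h
    refine ⟨by simp [Layer.src], ?_⟩
    have := ih h
    simpa [Layer.tgt, WeldedLink.whisker] using this

theorem IsTangle.tgt_unique {a b c : List (Strand ι)} {w : Word ι} (h : IsTangle a w b)
    (h' : IsTangle a w c) : b = c := by
  induction w generalizing a with
  | nil => exact h.symm.trans h'
  | cons l w ih => exact ih h.2 h'.2

theorem IsTangle.src_unique {a b c d : List (Strand ι)} {w : Word ι} (hw : w ≠ [])
    (h : IsTangle a w b) (h' : IsTangle c w d) : a = c := by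
  cases w with
  | nil => exact absurd rfl hw
  | cons l w => exact h.1.symm.trans h'.1

theorem whisker_append (L R : List (Strand ι)) (v w : Word ι) :
    whisker L (v ++ w) R = whisker L v R ++ whisker L w R := List.map_append

theorem whisker_whisker (L L' R R' : List (Strand ι)) (w : Word ι) :
    whisker L (whisker L' w R') R = whisker (L ++ L') w (R' ++ R) := by
  simp [whisker]

theorem whisker_ne_nil {L R : List (Strand ι)} {w : Word ι} (h : w ≠ []) :
    whisker L w R ≠ [] := by
  simpa [whisker] using h

/-- Two tangle diagrams with the same boundary are equivalent if replacing one by the other inside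
any closed diagram is realized by welded Reidemeister moves and `V^n`-moves. -/
structure TangleEquiv (n : ℕ) (a b : List (Strand ι)) (v w : Word ι) : Prop where
  fst : IsTangle a v b
  snd : IsTangle a w b
  equiv : ∀ (L R : List (Strand ι)) (w₁ w₂ : Word ι)
    (h : IsTangle [] (w₁ ++ whisker L v R ++ w₂) [])
    (h' : IsTangle [] (w₁ ++ whisker L w R ++ w₂) []),
    IsTangle [] w₁ (L ++ a ++ R) → IsTangle (L ++ b ++ R) w₂ [] →
    VEquiv n ⟨_, h⟩ ⟨_, h'⟩

namespace TangleEquiv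

variable {n : ℕ} {a b c : List (Strand ι)} {u v w : Word ι}

theorem refl (h : IsTangle a w b) : TangleEquiv n a b w w :=
  ⟨h, h, fun _ _ _ _ _ _ _ _ => .refl _⟩

theorem symm (h : TangleEquiv n a b v w) : TangleEquiv n a b w v :=
  ⟨h.snd, h.fst, fun L R w₁ w₂ h₁ h₂ k₁ k₂ => .symm _ _ (h.equiv L R w₁ w₂ h₂ h₁ k₁ k₂)⟩

theorem trans (h : TangleEquiv n a b u v) (h' : TangleEquiv n a b v w) :
    TangleEquiv n a b u w :=
  ⟨h.fst, h'.snd, fun L R w₁ w₂ h₁ h₂ k₁ k₂ => by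
    -- The intermediate diagram must be closed as well. This needs the boundaries of `w₁` and `w₂`,
    -- which an empty word in the middle would not determine; hence the last two hypotheses of
    -- `equiv`.
    have hv : IsTangle [] (w₁ ++ whisker L v R ++ w₂) [] :=
      isTangle_append.2 ⟨_, isTangle_append.2 ⟨_, k₁, h.snd.whisker L R⟩, k₂⟩
    exact .trans _ _ _ (h.equiv L R w₁ w₂ h₁ hv k₁ k₂) (h'.equiv L R w₁ w₂ hv h₂ k₁ k₂)⟩

theorem whisker (h : TangleEquiv n a b v w) (L R : List (Strand ι)) :
    TangleEquiv n (L ++ a ++ R) (L ++ b ++ R) (whisker L v R) (whisker L w R) :=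
  ⟨h.fst.whisker L R, h.snd.whisker L R, fun L' R' w₁ w₂ => by
    rw [whisker_whisker, whisker_whisker]
    intro h₁ h₂ k₁ k₂
    exact h.equiv _ _ w₁ w₂ h₁ h₂ (by simpa using k₁) (by simpa using k₂)⟩

theorem append_left (h : TangleEquiv n a b v w) (hu : IsTangle c u a) :
    TangleEquiv n c b (u ++ v) (u ++ w) :=
  ⟨isTangle_append.2 ⟨_, hu, h.fst⟩, isTangle_append.2 ⟨_, hu, h.snd⟩, fun L R w₁ w₂ => by
    simp only [whisker_append, ← List.append_assoc]
    intro h₁ h₂ k₁ k₂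
    exact h.equiv L R (w₁ ++ WeldedLink.whisker L u R) w₂ h₁ h₂
      (isTangle_append.2 ⟨_, by simpa using k₁, by simpa using hu.whisker L R⟩)
      (by simpa using k₂)⟩

theorem append_right (h : TangleEquiv n a b v w) (hu : IsTangle b u c) :
    TangleEquiv n a c (v ++ u) (w ++ u) :=
  ⟨isTangle_append.2 ⟨_, h.fst, hu⟩, isTangle_append.2 ⟨_, h.snd, hu⟩, fun L R w₁ w₂ => by
    simp only [whisker_append, List.append_assoc]
    intro h₁ h₂ k₁ k₂
    have := h.equiv L R w₁ (WeldedLink.whisker L u R ++ w₂) (by simpa using h₁) (by simpa using h₂)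
      (by simpa using k₁) (isTangle_append.2 ⟨_, hu.whisker L R, by simpa using k₂⟩)
    simpa using this⟩

/-- Replacement of a part of a tangle diagram. -/
theorem replace {a' b' d : List (Strand ι)} (h : TangleEquiv n a b v w) (L R : List (Strand ι))
    {x y : Word ι} (ha : a' = L ++ a ++ R) (hb : b' = L ++ b ++ R) (hx : IsTangle c x a')
    (hy : IsTangle b' y d) :
    TangleEquiv n c d (x ++ (WeldedLink.whisker L v R ++ y))
      (x ++ (WeldedLink.whisker L w R ++ y)) := by
  subst ha hb
  exact ((h.whisker L R).append_right hy).append_left hx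

theorem of_planarMove (h : PlanarMove v w) (hv : IsTangle a v b) (hw : IsTangle a w b) :
    TangleEquiv n a b v w :=
  ⟨hv, hw, fun L R w₁ w₂ _ _ _ _ => .rel _ _ (.inl (.mk _ _ w₁ w₂ v w L R h rfl rfl))⟩

theorem of_reidemeisterMove (h : ReidemeisterMove v w) (hv : IsTangle a v b)
    (hw : IsTangle a w b) : TangleEquiv n a b v w :=
  ⟨hv, hw, fun L R w₁ w₂ _ _ _ _ => .rel _ _ (.inr (.inl (.mk _ _ w₁ w₂ v w L R h rfl rfl)))⟩

theorem of_vMove (h : VMove n v w) (hv : IsTangle a v b) (hw : IsTangle a w b) :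
    TangleEquiv n a b v w :=
  ⟨hv, hw, fun L R w₁ w₂ _ _ _ _ => .rel _ _ (.inr (.inr (.mk _ _ w₁ w₂ v w L R h rfl rfl)))⟩

end TangleEquiv

theorem Kind.flip_flip (k : Kind) : k.flip.flip = k := by cases k <;> rfl

theorem Strand.rev_rev (s : Strand ι) : s.rev.rev = s := by simp [Strand.rev]

theorem TangleEquiv.two {n : ℕ} (k : Kind) (s t : Strand ι) :
    TangleEquiv n [s, t] [s, t] [⟨[], .cross k s t, []⟩, ⟨[], .cross k.flip t s, []⟩] [] :=
  .of_reidemeisterMove (.two k s t)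
    (by simp [IsTangle, Layer.src, Layer.tgt, Piece.src, Piece.tgt]) rfl

/-- Every crossing of `s` and `t` (from left to right at the bottom) can be made virtual. -/
def Virtualizable (s t : Strand ι) : Prop :=
  ∀ k, TangleEquiv 1 [s, t] [t, s] [⟨[], .cross k s t, []⟩] [⟨[], .cross .virt s t, []⟩]

theorem isTangle_cross (k : Kind) (s t : Strand ι) :
    IsTangle [s, t] [⟨[], .cross k s t, []⟩] [t, s] := by
  simp [IsTangle, Layer.src, Layer.tgt, Piece.src, Piece.tgt]

/-- The word virtual, virtual, over reduces in two ways: VR2 cancels the first two crossings, and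
the `V^1`-move cancels the last two. -/
theorem tangleEquiv_over_virt (c d : ι) :
    TangleEquiv 1 [⟨true, c⟩, ⟨true, d⟩] [⟨true, d⟩, ⟨true, c⟩]
      [⟨[], .cross .over ⟨true, c⟩ ⟨true, d⟩, []⟩]
      [⟨[], .cross .virt ⟨true, c⟩ ⟨true, d⟩, []⟩] := by
  have h₁ := (TangleEquiv.two (n := 1) .virt (⟨true, c⟩ : Strand ι) ⟨true, d⟩).append_right
    (isTangle_cross .over _ _)
  have h₂ := (TangleEquiv.of_vMove (n := 1) (VMove.mk d c) rfl
    (show IsTangle [⟨true, d⟩, ⟨true, c⟩] _ [⟨true, d⟩, ⟨true, c⟩] by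
      simp [virtualTwist, IsTangle, Layer.src, Layer.tgt, Piece.src, Piece.tgt])).append_left
    (isTangle_cross .virt ⟨true, c⟩ ⟨true, d⟩)
  exact (h₂.trans h₁).symm

theorem virtualizable_up (c d : ι) : Virtualizable ⟨true, c⟩ ⟨true, d⟩ := by
  rintro (_ | _ | _)
  · exact tangleEquiv_over_virt c d
  -- under ~ virtual, virtual, under ~ virtual, over, under ~ virtual, by VR2, the previous case and
  -- R2.
  · have h₁ := (TangleEquiv.two (n := 1) .virt (⟨true, c⟩ : Strand ι) ⟨true, d⟩).append_right
      (isTangle_cross .under _ _)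
    have h₂ := (tangleEquiv_over_virt d c).replace [] [] rfl rfl
      (isTangle_cross .virt ⟨true, c⟩ ⟨true, d⟩) (isTangle_cross .under ⟨true, c⟩ ⟨true, d⟩)
    have h₃ := (TangleEquiv.two (n := 1) .over (⟨true, d⟩ : Strand ι) ⟨true, c⟩).append_left
      (isTangle_cross .virt _ _)
    exact h₁.symm.trans (h₂.symm.trans h₃)
  · exact .refl (isTangle_cross _ _ _)

/-- Rotation of a crossing by a quarter turn. -/
theorem tangleEquiv_rotate (n : ℕ) (k : Kind) (s t : Strand ι) :
    TangleEquiv n [s, t] [t, s] [⟨[], .cross k s t, []⟩]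
      [⟨[s, t], .cup s.rev, []⟩, ⟨[s], .cross k.flip t s.rev, [s]⟩, ⟨[], .cap s, [t, s]⟩] := by
  -- A zigzag is inserted in `s` above the crossing, its minimum is lowered below the crossing, and
  -- the crossing is slid over the maximum.
  have h₁ := (TangleEquiv.of_planarMove (n := n) (PlanarMove.zigzag_right s)
    (show IsTangle [s] _ [s] by
      simp [IsTangle, Layer.src, Layer.tgt, Piece.src, Piece.tgt, Strand.rev_rev]) rfl).replace
    [t] [] rfl rfl (isTangle_cross k s t) (y := []) rfl
  have h₂ := (TangleEquiv.of_planarMove (n := n) (PlanarMove.exchange (.cross k s t) (.cup s.rev) [])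
    (show IsTangle [s, t] _ [t, s, s.rev, s] by
      simp [IsTangle, Layer.src, Layer.tgt, Piece.src, Piece.tgt, Strand.rev_rev])
    (by simp [IsTangle, Layer.src, Layer.tgt, Piece.src, Piece.tgt, Strand.rev_rev])).append_right
    (show IsTangle _ [⟨[t], .cap s, [s]⟩] [t, s] by
      simp [IsTangle, Layer.src, Layer.tgt, Piece.src, Piece.tgt])
  have h₃ := (TangleEquiv.of_planarMove (n := n) (PlanarMove.slide_cap k.flip s t)
    (show IsTangle [s, t, s.rev] _ [t] by
      simp [IsTangle, Layer.src, Layer.tgt, Piece.src, Piece.tgt])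
    (by simp [IsTangle, Layer.src, Layer.tgt, Piece.src, Piece.tgt])).replace [] [s] rfl rfl
    (show IsTangle [s, t] [⟨[s, t], .cup s.rev, []⟩] _ by
      simp [IsTangle, Layer.src, Layer.tgt, Piece.src, Piece.tgt, Strand.rev_rev]) (y := []) rfl
  simp only [WeldedLink.whisker, List.map_cons, List.map_nil, List.append_nil, List.nil_append,
    List.cons_append, Piece.src, Piece.tgt, Kind.flip_flip, Strand.rev_rev] at h₁ h₂ h₃
  exact h₁.symm.trans (h₂.trans h₃.symm)

theorem Virtualizable.rotate {s t : Strand ι} (h : Virtualizable t s.rev) : Virtualizable s t := by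
  intro k
  refine (tangleEquiv_rotate 1 k s t).trans (.trans ?_ (tangleEquiv_rotate 1 .virt s t).symm)
  have := (h k.flip).replace [s] [s] rfl rfl
    (show IsTangle [s, t] [⟨[s, t], .cup s.rev, []⟩] _ by
      simp [IsTangle, Layer.src, Layer.tgt, Piece.src, Piece.tgt, Strand.rev_rev])
    (show IsTangle _ [⟨[], .cap s, [t, s]⟩] [t, s] by
      simp [IsTangle, Layer.src, Layer.tgt, Piece.src, Piece.tgt])
  exact this

/-- Repeated quarter turns of a crossing of two upward strands run through all four combinations of
directions. -/
theorem virtualizable (s t : Strand ι) : Virtualizable s t := by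
  have hdu (c d : ι) : Virtualizable ⟨false, c⟩ ⟨true, d⟩ := (virtualizable_up d c).rotate
  have hdd (c d : ι) : Virtualizable ⟨false, c⟩ ⟨false, d⟩ := (hdu d c).rotate
  obtain ⟨_ | _, c⟩ := s <;> obtain ⟨_ | _, d⟩ := t
  · exact hdd c d
  · exact hdu c d
  · exact (hdd d c).rotate
  · exact virtualizable_up c d

theorem isTangle_triangleLeft (a b c : Kind) (s t u : Strand ι) :
    IsTangle [s, t, u] (triangleLeft a b c s t u) [u, t, s] := by
  simp [triangleLeft, IsTangle, Layer.src, Layer.tgt, Piece.src, Piece.tgt]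

theorem isTangle_triangleRight (a b c : Kind) (s t u : Strand ι) :
    IsTangle [s, t, u] (triangleRight a b c s t u) [u, t, s] := by
  simp [triangleRight, IsTangle, Layer.src, Layer.tgt, Piece.src, Piece.tgt]

theorem tangleEquiv_triangleLeft_virt (a b c : Kind) (s t u : Strand ι) :
    TangleEquiv 1 [s, t, u] [u, t, s] (triangleLeft a b c s t u)
      (triangleLeft .virt .virt .virt s t u) := by
  have h₁ := (virtualizable s t a).replace [] [u] rfl rfl (x := []) rfl
    (show IsTangle [t, s, u] [⟨[t], .cross b s u, []⟩, ⟨[], .cross c t u, [s]⟩] [u, t, s] by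
      simp [IsTangle, Layer.src, Layer.tgt, Piece.src, Piece.tgt])
  have h₂ := (virtualizable s u b).replace [t] [] rfl rfl
    (show IsTangle [s, t, u] [⟨[], .cross .virt s t, [u]⟩] _ by
      simp [IsTangle, Layer.src, Layer.tgt, Piece.src, Piece.tgt])
    (show IsTangle _ [⟨[], .cross c t u, [s]⟩] [u, t, s] by
      simp [IsTangle, Layer.src, Layer.tgt, Piece.src, Piece.tgt])
  have h₃ := (virtualizable t u c).replace [] [s] rfl rfl
    (show IsTangle [s, t, u] [⟨[], .cross .virt s t, [u]⟩, ⟨[t], .cross .virt s u, []⟩] _ by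
      simp [IsTangle, Layer.src, Layer.tgt, Piece.src, Piece.tgt]) (y := []) rfl
  exact h₁.trans (h₂.trans h₃)

theorem tangleEquiv_triangleRight_virt (a b c : Kind) (s t u : Strand ι) :
    TangleEquiv 1 [s, t, u] [u, t, s] (triangleRight a b c s t u)
      (triangleRight .virt .virt .virt s t u) := by
  have h₁ := (virtualizable t u c).replace [s] [] rfl rfl (x := []) rfl
    (show IsTangle [s, u, t] [⟨[], .cross b s u, [t]⟩, ⟨[u], .cross a s t, []⟩] [u, t, s] by
      simp [IsTangle, Layer.src, Layer.tgt, Piece.src, Piece.tgt])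
  have h₂ := (virtualizable s u b).replace [] [t] rfl rfl
    (show IsTangle [s, t, u] [⟨[s], .cross .virt t u, []⟩] _ by
      simp [IsTangle, Layer.src, Layer.tgt, Piece.src, Piece.tgt])
    (show IsTangle _ [⟨[u], .cross a s t, []⟩] [u, t, s] by
      simp [IsTangle, Layer.src, Layer.tgt, Piece.src, Piece.tgt])
  have h₃ := (virtualizable s t a).replace [u] [] rfl rfl
    (show IsTangle [s, t, u] [⟨[s], .cross .virt t u, []⟩, ⟨[], .cross .virt s u, [t]⟩] _ by
      simp [IsTangle, Layer.src, Layer.tgt, Piece.src, Piece.tgt]) (y := []) rfl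
  exact h₁.trans (h₂.trans h₃)

theorem tangleEquiv_triangle (a b c : Kind) (s t u : Strand ι) :
    TangleEquiv 1 [s, t, u] [u, t, s] (triangleLeft a b c s t u) (triangleRight a b c s t u) :=
  (tangleEquiv_triangleLeft_virt a b c s t u).trans
    ((TangleEquiv.of_reidemeisterMove (.virtual_three .virt .virt .virt (.fst _) s t u)
      (isTangle_triangleLeft _ _ _ s t u) (isTangle_triangleRight _ _ _ s t u)).trans
    (tangleEquiv_triangleRight_virt a b c s t u).symm)

/-- A nonempty word determines its own boundary, so the rest of the closed diagram has to fit it. -/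
theorem isTangle_unwhisker {L R a b : List (Strand ι)} {w w₁ w₂ : Word ι} (hw : w ≠ [])
    (h : IsTangle a w b) (hD : IsTangle [] (w₁ ++ whisker L w R ++ w₂) []) :
    IsTangle [] w₁ (L ++ a ++ R) ∧ IsTangle (L ++ b ++ R) w₂ [] := by
  obtain ⟨q, hq, h₂⟩ := isTangle_append.1 hD
  obtain ⟨p, h₁, hp⟩ := isTangle_append.1 hq
  obtain rfl := hp.src_unique (whisker_ne_nil hw) (h.whisker L R)
  obtain rfl := hp.tgt_unique (h.whisker L R)
  exact ⟨h₁, h₂⟩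

theorem ucRealizedByV_one : UCRealizedByV 1 := by
  rintro μ ⟨⟨D, hD⟩, _, _⟩ ⟨⟨D', hD'⟩, _, _⟩ hstep
  cases hstep with
  | mk w₁ w₂ m m' L R hm h h' =>
    cases hm with
    | undercrossings a b c _ s t u =>
      dsimp only at h h'
      subst h h'
      obtain ⟨h₁, h₂⟩ := isTangle_unwhisker (by simp [triangleLeft])
        (isTangle_triangleLeft a b c s t u) hD
      exact (tangleEquiv_triangle a b c s t u).equiv L R w₁ w₂ hD hD' h₁ h₂

end Tangles

/-! ### Quandle colourings compatible with labels. -/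

section Colorings

variable {ι Q : Type}

section Matching

variable (ℓ : Q → ι)

/-- Colours of the points on a horizontal line, compatible with the labels. -/
def Matches (S : List (Strand ι)) (X : List Q) : Prop :=
  List.Forall₂ (fun s x => ℓ x = s.label) S X

@[simp] theorem matches_nil_iff {X : List Q} : Matches ℓ [] X ↔ X = [] :=
  List.forall₂_nil_left_iff

@[simp] theorem matches_cons_cons {s : Strand ι} {S : List (Strand ι)} {x : Q} {X : List Q} :
    Matches ℓ (s :: S) (x :: X) ↔ ℓ x = s.label ∧ Matches ℓ S X := List.forall₂_cons

theorem matches_cons_iff {s : Strand ι} {S : List (Strand ι)} {X : List Q} :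
    Matches ℓ (s :: S) X ↔ ∃ x X', ℓ x = s.label ∧ Matches ℓ S X' ∧ X = x :: X' :=
  List.forall₂_cons_left_iff

theorem matches_append_iff {S T : List (Strand ι)} {X : List Q} :
    Matches ℓ (S ++ T) X ↔ ∃ A B, Matches ℓ S A ∧ Matches ℓ T B ∧ X = A ++ B := by
  induction S generalizing X with
  | nil => simp
  | cons s S ih =>
    simp only [List.cons_append, matches_cons_iff, ih]
    constructor
    · rintro ⟨x, _, hx, ⟨A, B, hA, hB, rfl⟩, rfl⟩
      exact ⟨x :: A, B, ⟨x, A, hx, hA, rfl⟩, hB, rfl⟩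
    · rintro ⟨_, B, ⟨x, A, hx, hA, rfl⟩, hB, rfl⟩
      exact ⟨x, _, hx, ⟨A, B, hA, hB, rfl⟩, rfl⟩

variable {ℓ}

theorem Matches.length_eq {S : List (Strand ι)} {X : List Q} (h : Matches ℓ S X) :
    S.length = X.length := List.Forall₂.length_eq h

theorem Matches.append {S T : List (Strand ι)} {X Y : List Q} (h : Matches ℓ S X)
    (h' : Matches ℓ T Y) : Matches ℓ (S ++ T) (X ++ Y) :=
  (matches_append_iff ℓ).2 ⟨X, Y, h, h', rfl⟩

theorem Matches.append_inj {S : List (Strand ι)} {A A' B B' : List Q} (h : Matches ℓ S A)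
    (h' : Matches ℓ S A') (he : A ++ B = A' ++ B') : A = A' ∧ B = B' :=
  List.append_inj he (h.length_eq.symm.trans h'.length_eq)

end Matching

variable [Quandle Q]

/-- The action of the colour `y` of an overcrossing strand, directed upwards or downwards, on the
colour of a strand passing under it from right to left. -/
def signedAct (b : Bool) (y : Q) : Equiv.Perm Q := if b then Rack.act' y else (Rack.act' y)⁻¹

theorem signedAct_not (b : Bool) (y : Q) : signedAct (!b) y = (signedAct b y)⁻¹ := by
  cases b <;> simp [signedAct]

theorem signedAct_self (b : Bool) (x : Q) : signedAct b x x = x := by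
  cases b <;> simp [signedAct, Quandle.fix, Quandle.fix_inv]

theorem signedAct_eq_iff {b : Bool} {x y : Q} : signedAct b y x = y ↔ x = y := by
  rw [← (signedAct b y).apply_eq_iff_eq (x := x), signedAct_self]

/-- Self-distributivity of the rack, extended to inverse actions. It is the algebraic content of R3.
-/
theorem signedAct_conj (b b' : Bool) (x y : Q) :
    signedAct b (signedAct b' y x) = signedAct b' y * signedAct b x * (signedAct b' y)⁻¹ := by
  have key (b : Bool) (x : Q) :
      signedAct b (Rack.act' y x) = Rack.act' y * signedAct b x * (Rack.act' y)⁻¹ := by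
    cases b <;> simp [signedAct, Rack.ad_conj, mul_assoc]
  cases b'
  · obtain ⟨x, rfl⟩ := (Rack.act' y).surjective x
    change signedAct b ((Rack.act' y)⁻¹ (Rack.act' y x)) =
      (Rack.act' y)⁻¹ * signedAct b (Rack.act' y x) * ((Rack.act' y)⁻¹)⁻¹
    rw [key b x, show (Rack.act' y)⁻¹ (Rack.act' y x) = x from (Rack.act' y).symm_apply_apply x]
    group
  · simpa [signedAct] using key b x

theorem signedAct_distrib (b b' : Bool) (x y z : Q) :
    signedAct b (signedAct b' y x) (signedAct b' y z) = signedAct b' y (signedAct b x z) := by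
  simp [signedAct_conj]

/-- The colours of `s` and `t` after a crossing at the bottom of which they are `x` and `y`. -/
def crossColors (k : Kind) (s t : Strand ι) (x y : Q) : Q × Q :=
  match k with
  | .over => (x, signedAct s.up x y)
  | .under => (signedAct (!t.up) y x, y)
  | .virt => (x, y)

variable (ℓ : Q → ι)

/-- The relation between the colours at the bottom and at the top of a piece. -/
def PieceRel : Piece ι → List Q → List Q → Prop
  | .cross k s t, X, Y => ∃ x y, ℓ x = s.label ∧ ℓ y = t.label ∧ X = [x, y] ∧
      Y = [(crossColors k s t x y).2, (crossColors k s t x y).1]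
  | .cup s, X, Y => ∃ x, ℓ x = s.label ∧ X = [] ∧ Y = [x, x]
  | .cap s, X, Y => ∃ x, ℓ x = s.label ∧ X = [x, x] ∧ Y = []

/-- A relation rather than a function, because a minimum creates a free colour and a maximum forces
two colours to agree. -/
def LayerRel (l : Layer ι) (X Y : List Q) : Prop :=
  ∃ A U V B, Matches ℓ l.left A ∧ Matches ℓ l.right B ∧ PieceRel ℓ l.piece U V ∧
    X = A ++ (U ++ B) ∧ Y = A ++ (V ++ B)

/-- `WordRel ℓ w X Y`: the diagram `w` has a colouring with bottom colours `X` and top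
colours `Y`. -/
def WordRel : Word ι → List Q → List Q → Prop
  | [], X, Y => X = Y
  | l :: w, X, Y => ∃ Z, LayerRel ℓ l X Z ∧ WordRel w Z Y

variable {ℓ}

theorem layerRel_cons {s : Strand ι} {L R : List (Strand ι)} {p : Piece ι} {x : Q}
    {X Z : List Q} : LayerRel ℓ ⟨s :: L, p, R⟩ (x :: X) Z ↔
      ℓ x = s.label ∧ ∃ Z', Z = x :: Z' ∧ LayerRel ℓ ⟨L, p, R⟩ X Z' := by
  simp only [LayerRel, matches_cons_iff]
  constructor
  · rintro ⟨_, U, V, B, ⟨x', A, hx, hA, rfl⟩, hB, hp, h, rfl⟩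
    obtain ⟨rfl, rfl⟩ := List.cons.inj h
    exact ⟨hx, _, rfl, A, U, V, B, hA, hB, hp, rfl, rfl⟩
  · rintro ⟨hx, _, rfl, A, U, V, B, hA, hB, hp, rfl, rfl⟩
    exact ⟨_, U, V, B, ⟨x, A, hx, hA, rfl⟩, hB, hp, rfl, rfl⟩

theorem layerRel_cross {R : List (Strand ι)} {k : Kind} {s t : Strand ι} {x y : Q}
    {X Z : List Q} : LayerRel ℓ ⟨[], .cross k s t, R⟩ (x :: y :: X) Z ↔
      ℓ x = s.label ∧ ℓ y = t.label ∧ Matches ℓ R X ∧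
        Z = (crossColors k s t x y).2 :: (crossColors k s t x y).1 :: X := by
  simp only [LayerRel, PieceRel, matches_nil_iff]
  constructor
  · rintro ⟨_, _, _, B, rfl, hB, ⟨x', y', hx, hy, rfl, rfl⟩, h, rfl⟩
    simp only [List.nil_append, List.cons_append, List.cons.injEq] at h
    obtain ⟨rfl, rfl, rfl⟩ := h
    exact ⟨hx, hy, hB, rfl⟩
  · rintro ⟨hx, hy, hB, rfl⟩
    exact ⟨[], _, _, X, rfl, hB, ⟨x, y, hx, hy, rfl, rfl⟩, rfl, rfl⟩

theorem layerRel_cup {R : List (Strand ι)} {s : Strand ι} {X Z : List Q} :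
    LayerRel ℓ ⟨[], .cup s, R⟩ X Z ↔
      Matches ℓ R X ∧ ∃ x, ℓ x = s.label ∧ Z = x :: x :: X := by
  simp only [LayerRel, PieceRel, matches_nil_iff]
  constructor
  · rintro ⟨_, _, _, B, rfl, hB, ⟨x, hx, rfl, rfl⟩, rfl, rfl⟩
    exact ⟨hB, x, hx, rfl⟩
  · rintro ⟨hB, x, hx, rfl⟩
    exact ⟨[], _, _, X, rfl, hB, ⟨x, hx, rfl, rfl⟩, rfl, rfl⟩

theorem layerRel_cap {R : List (Strand ι)} {s : Strand ι} {x y : Q} {X Z : List Q} :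
    LayerRel ℓ ⟨[], .cap s, R⟩ (x :: y :: X) Z ↔
      ℓ x = s.label ∧ x = y ∧ Matches ℓ R X ∧ Z = X := by
  simp only [LayerRel, PieceRel, matches_nil_iff]
  constructor
  · rintro ⟨_, _, _, B, rfl, hB, ⟨x', hx, rfl, rfl⟩, h, rfl⟩
    simp only [List.nil_append, List.cons_append, List.cons.injEq] at h
    obtain ⟨rfl, rfl, rfl⟩ := h
    exact ⟨hx, rfl, hB, rfl⟩
  · rintro ⟨hx, rfl, hB, rfl⟩
    exact ⟨[], _, _, _, rfl, hB, ⟨x, hx, rfl, rfl⟩, rfl, rfl⟩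

theorem wordRel_append {v w : Word ι} {X Y : List Q} :
    WordRel ℓ (v ++ w) X Y ↔ ∃ Z, WordRel ℓ v X Z ∧ WordRel ℓ w Z Y := by
  induction v generalizing X with
  | nil => simp [WordRel]
  | cons l v ih =>
    simp only [List.cons_append, WordRel, ih]
    constructor
    · rintro ⟨Z, h, Z', h', h''⟩
      exact ⟨Z', ⟨Z, h, h'⟩, h''⟩
    · rintro ⟨Z', ⟨Z, h, h'⟩, h''⟩
      exact ⟨Z, h, Z', h', h''⟩

/-- Labels of colours are preserved by the quandle operation. -/
def IsLabelling (ℓ : Q → ι) : Prop := ∀ x y, ℓ (Rack.act' x y) = ℓ y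

theorem IsLabelling.signedAct (hℓ : IsLabelling ℓ) (b : Bool) (x y : Q) :
    ℓ (signedAct b x y) = ℓ y := by
  cases b
  · obtain ⟨y, rfl⟩ := (Rack.act' x).surjective y
    simpa [WeldedLink.signedAct] using (hℓ x y).symm
  · exact hℓ x y

theorem IsLabelling.crossColors_fst (hℓ : IsLabelling ℓ) (k : Kind) (s t : Strand ι) (x y : Q) :
    ℓ (crossColors k s t x y).1 = ℓ x := by
  cases k <;> simp [crossColors, hℓ.signedAct]

theorem IsLabelling.crossColors_snd (hℓ : IsLabelling ℓ) (k : Kind) (s t : Strand ι) (x y : Q) :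
    ℓ (crossColors k s t x y).2 = ℓ y := by
  cases k <;> simp [crossColors, hℓ.signedAct]

theorem PieceRel.matches_src {p : Piece ι} {U V : List Q} (h : PieceRel ℓ p U V) :
    Matches ℓ p.src U := by
  cases p with
  | cross k s t =>
    obtain ⟨x, y, hx, hy, rfl, rfl⟩ := h
    simp [Piece.src, hx, hy]
  | cup s =>
    obtain ⟨x, hx, rfl, rfl⟩ := h
    simp [Piece.src]
  | cap s =>
    obtain ⟨x, hx, rfl, rfl⟩ := h
    simp [Piece.src, Strand.rev, hx]

theorem PieceRel.matches_tgt (hℓ : IsLabelling ℓ) {p : Piece ι} {U V : List Q}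
    (h : PieceRel ℓ p U V) : Matches ℓ p.tgt V := by
  cases p with
  | cross k s t =>
    obtain ⟨x, y, hx, hy, rfl, rfl⟩ := h
    simp [Piece.tgt, hx, hy, hℓ.crossColors_fst, hℓ.crossColors_snd]
  | cup s =>
    obtain ⟨x, hx, rfl, rfl⟩ := h
    simp [Piece.tgt, Strand.rev, hx]
  | cap s =>
    obtain ⟨x, hx, rfl, rfl⟩ := h
    simp [Piece.tgt]

theorem LayerRel.matches_src {l : Layer ι} {X Y : List Q} (h : LayerRel ℓ l X Y) :
    Matches ℓ l.src X := by
  obtain ⟨A, U, V, B, hA, hB, hp, rfl, rfl⟩ := h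
  rw [Layer.src, List.append_assoc]
  exact hA.append (hp.matches_src.append hB)

theorem LayerRel.matches_tgt (hℓ : IsLabelling ℓ) {l : Layer ι} {X Y : List Q}
    (h : LayerRel ℓ l X Y) : Matches ℓ l.tgt Y := by
  obtain ⟨A, U, V, B, hA, hB, hp, rfl, rfl⟩ := h
  rw [Layer.tgt, List.append_assoc]
  exact hA.append ((hp.matches_tgt hℓ).append hB)

theorem WordRel.matches_tgt (hℓ : IsLabelling ℓ) {a b : List (Strand ι)} {w : Word ι}
    {X Y : List Q} (ht : IsTangle a w b) (hX : Matches ℓ a X) (h : WordRel ℓ w X Y) :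
    Matches ℓ b Y := by
  induction w generalizing a X with
  | nil =>
    obtain rfl : a = b := ht
    obtain rfl : X = Y := h
    exact hX
  | cons l w ih =>
    obtain ⟨Z, hZ, h⟩ := h
    exact ih ht.2 (hZ.matches_tgt hℓ) h

theorem layerRel_whisker {L R : List (Strand ι)} {A B : List Q} (hA : Matches ℓ L A)
    (hB : Matches ℓ R B) {l : Layer ι} {X Z : List Q} (hX : Matches ℓ l.src X) :
    LayerRel ℓ ⟨L ++ l.left, l.piece, l.right ++ R⟩ (A ++ (X ++ B)) Z ↔
      ∃ Z', Z = A ++ (Z' ++ B) ∧ LayerRel ℓ l X Z' := by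
  constructor
  · rintro ⟨A', U, V, B', hA', hB', hp, h, rfl⟩
    obtain ⟨A₁, A₂, hA₁, hA₂, rfl⟩ := (matches_append_iff ℓ).1 hA'
    obtain ⟨B₁, B₂, hB₁, hB₂, rfl⟩ := (matches_append_iff ℓ).1 hB'
    rw [List.append_assoc] at h
    obtain ⟨rfl, h⟩ := hA.append_inj hA₁ h
    have hX' : Matches ℓ l.src (A₂ ++ (U ++ B₁)) := by
      rw [Layer.src, List.append_assoc]
      exact hA₂.append (hp.matches_src.append hB₁)
    obtain ⟨rfl, rfl⟩ := hX.append_inj (B' := B₂) hX' (by simpa using h)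
    exact ⟨A₂ ++ (V ++ B₁), by simp, A₂, U, V, B₁, hA₂, hB₁, hp, rfl, rfl⟩
  · rintro ⟨_, rfl, A', U, V, B', hA', hB', hp, rfl, rfl⟩
    exact ⟨A ++ A', U, V, B' ++ B, hA.append hA', hB'.append hB, hp, by simp, by simp⟩

theorem wordRel_whisker (hℓ : IsLabelling ℓ) {L R : List (Strand ι)} {A B : List Q}
    (hA : Matches ℓ L A) (hB : Matches ℓ R B) {a b : List (Strand ι)} {w : Word ι}
    (ht : IsTangle a w b) {X Z : List Q} (hX : Matches ℓ a X) :
    WordRel ℓ (whisker L w R) (A ++ (X ++ B)) Z ↔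
      ∃ Z', Z = A ++ (Z' ++ B) ∧ WordRel ℓ w X Z' := by
  induction w generalizing a X with
  | nil => simp [whisker, WordRel, eq_comm]
  | cons l w ih =>
    obtain ⟨rfl, ht⟩ := ht
    change (∃ Y, LayerRel ℓ ⟨L ++ l.left, l.piece, l.right ++ R⟩ _ Y ∧ WordRel ℓ (whisker L w R) Y Z) ↔
      ∃ Z', Z = _ ∧ ∃ Y, LayerRel ℓ l X Y ∧ WordRel ℓ w Y Z'
    constructor
    · rintro ⟨_, hY', h'⟩
      obtain ⟨Y, rfl, hY⟩ := (layerRel_whisker hA hB hX).1 hY'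
      obtain ⟨Z', rfl, h⟩ := (ih ht (hY.matches_tgt hℓ)).1 h'
      exact ⟨Z', rfl, Y, hY, h⟩
    · rintro ⟨Z', rfl, Y, hY, h⟩
      exact ⟨_, (layerRel_whisker hA hB hX).2 ⟨Y, rfl, hY⟩,
        (ih ht (hY.matches_tgt hℓ)).2 ⟨Z', rfl, h⟩⟩

/-- A local move that does not change the relation between the colours of the endpoints. -/
def PreservesColorings (ℓ : Q → ι) (m m' : Word ι) : Prop :=
  (m ≠ [] ∨ m' ≠ []) ∧ ∃ a b, IsTangle a m b ∧ IsTangle a m' b ∧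
    ∀ X Y, Matches ℓ a X → (WordRel ℓ m X Y ↔ WordRel ℓ m' X Y)

theorem PreservesColorings.step (hℓ : IsLabelling ℓ) {M : Word ι → Word ι → Prop}
    (hM : ∀ m m', M m m' → PreservesColorings ℓ m m') {D D' : ClosedDiagram ι}
    (h : Step M D D') : WordRel ℓ D.1 [] [] ↔ WordRel ℓ D'.1 [] [] := by
  obtain ⟨w₁, w₂, m, m', L, R, hm, hD, hD'⟩ := h
  obtain ⟨hne, a, b, hma, hma', hrel⟩ := hM _ _ hm
  have h₁ : IsTangle [] w₁ (L ++ a ++ R) := by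
    -- One side of the move may be empty; the boundary below the disk is read off from a nonempty
    -- side.
    rcases hne with hne | hne
    · exact (isTangle_unwhisker hne hma (hD ▸ D.2)).1
    · exact (isTangle_unwhisker hne hma' (hD' ▸ D'.2)).1
  rw [hD, hD']
  simp only [wordRel_append]
  refine exists_congr fun Z => and_congr_left fun _ => exists_congr fun Y =>
    and_congr_right fun hY => ?_
  -- The empty word imposes no label condition, so `hrel` is only available for colours matching the
  -- boundary. Here they match because labels propagate upwards from the empty bottom line.
  have := hY.matches_tgt hℓ h₁ (by simp)
  rw [List.append_assoc, matches_append_iff] at this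
  obtain ⟨A, _, hA, hXB, rfl⟩ := this
  obtain ⟨X, B, hX, hB, rfl⟩ := (matches_append_iff ℓ).1 hXB
  rw [wordRel_whisker hℓ hA hB hma hX, wordRel_whisker hℓ hA hB hma' hX]
  simp only [hrel _ _ hX]

/-! ### Invariance of colourings under the individual moves. -/

theorem preservesColorings_planarMove (hℓ : IsLabelling ℓ) {m m' : Word ι} (h : PlanarMove m m') :
    PreservesColorings ℓ m m' := by
  cases h with
  | exchange g h M =>
    refine ⟨by simp, g.src ++ (M ++ h.src), g.tgt ++ (M ++ h.tgt),
      by simp [IsTangle, Layer.src, Layer.tgt], by simp [IsTangle, Layer.src, Layer.tgt], ?_⟩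
    intro X Y _
    constructor
    · rintro ⟨_, ⟨_, U, V, B, hA, hB, hg, rfl, rfl⟩, _, ⟨A, P, P', B', hA', hB', hh, he, rfl⟩, rfl⟩
      obtain rfl := (matches_nil_iff ℓ).1 hA
      obtain rfl := (matches_nil_iff ℓ).1 hB'
      obtain ⟨V', N, hV', hN, rfl⟩ := (matches_append_iff ℓ).1 hA'
      simp only [List.nil_append, List.append_nil, List.append_assoc] at he
      obtain ⟨rfl, rfl⟩ := (hg.matches_tgt hℓ).append_inj hV' he
      exact ⟨U ++ (N ++ P'), ⟨U ++ N, P, P', [], hg.matches_src.append hN, hB', hh, by simp,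
        by simp⟩, _, ⟨[], U, V, N ++ P', hA, hN.append (hh.matches_tgt hℓ), hg, rfl, rfl⟩, by simp [WordRel]⟩
    · rintro ⟨_, ⟨A, P, P', B', hA', hB', hh, rfl, rfl⟩, _, ⟨_, U, V, B, hA, hB, hg, he, rfl⟩, rfl⟩
      obtain rfl := (matches_nil_iff ℓ).1 hA
      obtain rfl := (matches_nil_iff ℓ).1 hB'
      obtain ⟨U', N, hU', hN, rfl⟩ := (matches_append_iff ℓ).1 hA'
      simp only [List.nil_append, List.append_nil, List.append_assoc] at he
      obtain ⟨rfl, rfl⟩ := hU'.append_inj hg.matches_src he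
      exact ⟨V ++ (N ++ P), ⟨[], U', V, N ++ P, hA, hN.append hh.matches_src, hg, by simp, rfl⟩,
        _, ⟨V ++ N, P, P', [], (hg.matches_tgt hℓ).append hN, hB', hh, by simp, rfl⟩, by simp [WordRel]⟩
  | zigzag_left s =>
    refine ⟨by simp, [s], [s],
      by simp [IsTangle, Layer.src, Layer.tgt, Piece.src, Piece.tgt, Strand.rev_rev], rfl, ?_⟩
    intro X Y hX
    simp only [matches_cons_iff, matches_nil_iff] at hX
    obtain ⟨x, _, hx, rfl, rfl⟩ := hX
    simp [WordRel, layerRel_cons, layerRel_cup, layerRel_cap, Strand.rev, hx, eq_comm]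
  | zigzag_right s =>
    refine ⟨by simp, [s], [s],
      by simp [IsTangle, Layer.src, Layer.tgt, Piece.src, Piece.tgt, Strand.rev_rev], rfl, ?_⟩
    intro X Y hX
    simp only [matches_cons_iff, matches_nil_iff] at hX
    obtain ⟨x, _, hx, rfl, rfl⟩ := hX
    simp [WordRel, layerRel_cons, layerRel_cup, layerRel_cap, Strand.rev, hx, eq_comm]
  | slide_cap k s t =>
    refine ⟨by simp, [s, t, s.rev], [t],
      by simp [IsTangle, Layer.src, Layer.tgt, Piece.src, Piece.tgt],
      by simp [IsTangle, Layer.src, Layer.tgt, Piece.src, Piece.tgt], ?_⟩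
    intro X Y hX
    simp only [matches_cons_iff, matches_nil_iff] at hX
    obtain ⟨x, _, hx, ⟨y, _, hy, ⟨z, _, hz, rfl, rfl⟩, rfl⟩, rfl⟩ := hX
    simp [WordRel, layerRel_cons, layerRel_cross, layerRel_cap, hx, hy, hz, hℓ.crossColors_fst,
      hℓ.crossColors_snd]
    cases k
    · simp only [crossColors, Kind.flip, signedAct_not, Equiv.Perm.inv_eq_iff_eq, and_comm]
    · simp only [crossColors, Kind.flip, Strand.rev, Bool.not_not, and_comm (a := x = z)]
      exact and_congr_left fun h => by rw [h]
    · simp [crossColors, Kind.flip, and_comm]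
  | slide_cup k s t =>
    refine ⟨by simp, [t], [s, t, s.rev],
      by simp [IsTangle, Layer.src, Layer.tgt, Piece.src, Piece.tgt],
      by simp [IsTangle, Layer.src, Layer.tgt, Piece.src, Piece.tgt], ?_⟩
    intro X Y hX
    simp only [matches_cons_iff, matches_nil_iff] at hX
    obtain ⟨x, _, hx, rfl, rfl⟩ := hX
    simp [WordRel, layerRel_cons, layerRel_cross, layerRel_cup, hx]
    cases k
    · simp [crossColors, Kind.flip, Strand.rev, and_comm]
    · simp only [crossColors, Kind.flip, Strand.rev]
      constructor
      · rintro ⟨y, hy, rfl, -⟩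
        exact ⟨signedAct (!t.up) x y, by simp [hℓ.signedAct, hy], by simp [hℓ.signedAct, hy],
          by simp [signedAct_not]⟩
      · rintro ⟨y, hy, -, rfl⟩
        exact ⟨signedAct t.up x y, by simp [hℓ.signedAct, hy], by simp [signedAct_not],
          by simp [hℓ.signedAct, hy]⟩
    · simp [crossColors, Kind.flip, Strand.rev, and_comm]

theorem wordRel_triangleLeft (hℓ : IsLabelling ℓ) {a b c : Kind} {s t u : Strand ι} {x y z : Q}
    (hx : ℓ x = s.label) (hy : ℓ y = t.label) (hz : ℓ z = u.label) {Y : List Q} :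
    WordRel ℓ (triangleLeft a b c s t u) [x, y, z] Y ↔
      Y = [(crossColors c t u (crossColors a s t x y).2
              (crossColors b s u (crossColors a s t x y).1 z).2).2,
        (crossColors c t u (crossColors a s t x y).2
              (crossColors b s u (crossColors a s t x y).1 z).2).1,
        (crossColors b s u (crossColors a s t x y).1 z).1] := by
  simp [triangleLeft, WordRel, layerRel_cons, layerRel_cross, hx, hy, hz, hℓ.crossColors_fst,
    hℓ.crossColors_snd, eq_comm]

theorem wordRel_triangleRight (hℓ : IsLabelling ℓ) {a b c : Kind} {s t u : Strand ι} {x y z : Q}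
    (hx : ℓ x = s.label) (hy : ℓ y = t.label) (hz : ℓ z = u.label) {Y : List Q} :
    WordRel ℓ (triangleRight a b c s t u) [x, y, z] Y ↔
      Y = [(crossColors b s u x (crossColors c t u y z).2).2,
        (crossColors a s t (crossColors b s u x (crossColors c t u y z).2).1
              (crossColors c t u y z).1).2,
        (crossColors a s t (crossColors b s u x (crossColors c t u y z).2).1
              (crossColors c t u y z).1).1] := by
  simp [triangleRight, WordRel, layerRel_cons, layerRel_cross, hx, hy, hz, hℓ.crossColors_fst,
    hℓ.crossColors_snd, eq_comm]

theorem preservesColorings_triangle (hℓ : IsLabelling ℓ) {a b c : Kind} {s t u : Strand ι}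
    (h : IsR3 a b c ∨ IsVR34 a b c ∨ IsOC a b c) :
    PreservesColorings ℓ (triangleLeft a b c s t u) (triangleRight a b c s t u) := by
  refine ⟨by simp [triangleLeft], _, _, isTangle_triangleLeft a b c s t u,
    isTangle_triangleRight a b c s t u, ?_⟩
  intro X Y hX
  simp only [matches_cons_iff, matches_nil_iff] at hX
  obtain ⟨x, _, hx, ⟨y, _, hy, ⟨z, _, hz, rfl, rfl⟩, rfl⟩, rfl⟩ := hX
  rw [wordRel_triangleLeft hℓ hx hy hz, wordRel_triangleRight hℓ hx hy hz]
  refine Eq.congr_right ?_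
  rcases h with ⟨ha, hb, hc, h⟩ | h | h
  · cases a <;> cases b <;> cases c <;> simp_all [crossColors, signedAct_distrib]
    -- In the two cases left, `t` is the top strand. It acts on the colours of `s` and `u` from
    -- opposite sides, hence by mutually inverse permutations, which cancel after distributing.
    · rw [← signedAct_distrib]
      simp [signedAct_not]
    · rw [← signedAct_distrib (!u.up) (!t.up) (signedAct t.up y z) y x]
      simp [signedAct_not]
  · cases h <;> rename_i k <;> cases k <;> simp [crossColors]
  · cases h <;> simp [crossColors]

theorem preservesColorings_reidemeisterMove (hℓ : IsLabelling ℓ) {m m' : Word ι}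
    (h : ReidemeisterMove m m') : PreservesColorings ℓ m m' := by
  cases h with
  | one_right k s =>
    refine ⟨by simp, [s], [s],
      by simp [IsTangle, Layer.src, Layer.tgt, Piece.src, Piece.tgt], rfl, ?_⟩
    intro X Y hX
    simp only [matches_cons_iff, matches_nil_iff] at hX
    obtain ⟨x, _, hx, rfl, rfl⟩ := hX
    simp [WordRel, layerRel_cons, layerRel_cup, layerRel_cap, layerRel_cross, hx,
      hℓ.crossColors_fst, hℓ.crossColors_snd]
    have hr : s.rev.label = s.label := rfl
    constructor
    · rintro ⟨y, -, -, -, rfl, h⟩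
      cases k <;> simp_all [crossColors, signedAct_eq_iff, signedAct_self]
    · rintro rfl
      exact ⟨x, by cases k <;> simp [crossColors, signedAct_self, hx, hr]⟩
  | one_left k s =>
    refine ⟨by simp, [s], [s],
      by simp [IsTangle, Layer.src, Layer.tgt, Piece.src, Piece.tgt, Strand.rev_rev], rfl, ?_⟩
    intro X Y hX
    simp only [matches_cons_iff, matches_nil_iff] at hX
    obtain ⟨x, _, hx, rfl, rfl⟩ := hX
    simp [WordRel, layerRel_cons, layerRel_cup, layerRel_cap, layerRel_cross, hx,
      hℓ.crossColors_fst]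
    have hr : s.rev.label = s.label := rfl
    constructor
    · rintro ⟨y, -, -, -, h, -, rfl⟩
      cases k <;> simp_all [crossColors, eq_comm (a := y), signedAct_eq_iff, signedAct_self]
    · rintro rfl
      exact ⟨x, by cases k <;> simp [crossColors, signedAct_self, hx, hr]⟩
  | two k s t =>
    refine ⟨by simp, [s, t], [s, t],
      by simp [IsTangle, Layer.src, Layer.tgt, Piece.src, Piece.tgt], rfl, ?_⟩
    intro X Y hX
    simp only [matches_cons_iff, matches_nil_iff] at hX
    obtain ⟨x, _, hx, ⟨y, _, hy, rfl, rfl⟩, rfl⟩ := hX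
    simp [WordRel, layerRel_cross, hx, hy, hℓ.crossColors_fst, hℓ.crossColors_snd, eq_comm]
    cases k <;> simp [crossColors, Kind.flip, signedAct_not]
  | three a b c h s t u => exact preservesColorings_triangle hℓ (.inl h)
  | virtual_three a b c h s t u => exact preservesColorings_triangle hℓ (.inr (.inl h))
  | overcrossings a b c h s t u => exact preservesColorings_triangle hℓ (.inr (.inr h))

theorem isTangle_virtualTwist (n : ℕ) (s t : Strand ι) :
    IsTangle [s, t] (virtualTwist n s t) [s, t] := by
  induction n with
  | zero => rfl
  | succ n ih =>
    simpa [virtualTwist, List.replicate_succ, IsTangle, Layer.src, Layer.tgt, Piece.src, Piece.tgt]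
      using ih

theorem wordRel_virtualTwist (hℓ : IsLabelling ℓ) {n : ℕ} {s t : Strand ι} {x y : Q}
    (hx : ℓ x = s.label) (hy : ℓ y = t.label) {Y : List Q} :
    WordRel ℓ (virtualTwist n s t) [x, y] Y ↔ Y = [(signedAct t.up y ^ n) x, y] := by
  induction n generalizing x with
  | zero => simp [virtualTwist, WordRel, eq_comm]
  | succ n ih =>
    have := ih (x := signedAct t.up y x) (by simp [hℓ.signedAct, hx])
    simp only [virtualTwist] at this
    simp [virtualTwist, List.replicate_succ, WordRel, layerRel_cross, crossColors, hx, hy, this,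
      pow_succ]

theorem preservesColorings_vMove (hℓ : IsLabelling ℓ) {n : ℕ} (hn : n ≠ 0)
    (hQ : ∀ y : Q, Rack.act' y ^ n = 1) {m m' : Word ι} (h : VMove n m m') :
    PreservesColorings ℓ m m' := by
  cases h with
  | mk c d =>
    refine ⟨.inr ?_, _, _, rfl, isTangle_virtualTwist n _ _, ?_⟩
    · obtain ⟨k, rfl⟩ := Nat.exists_eq_succ_of_ne_zero hn
      simp [virtualTwist, List.replicate_succ]
    intro X Y hX
    simp only [matches_cons_iff, matches_nil_iff] at hX
    obtain ⟨x, _, hx, ⟨y, _, hy, rfl, rfl⟩, rfl⟩ := hX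
    rw [wordRel_virtualTwist hℓ hx hy]
    simp [signedAct, hQ, WordRel, eq_comm]

theorem VEquiv.wordRel_iff (hℓ : IsLabelling ℓ) {n : ℕ} (hn : n ≠ 0)
    (hQ : ∀ y : Q, Rack.act' y ^ n = 1) {D D' : ClosedDiagram ι} (h : VEquiv n D D') :
    WordRel ℓ D.1 [] [] ↔ WordRel ℓ D'.1 [] [] := by
  induction h with
  | rel D D' h =>
    rcases h with h | h | h
    · exact PreservesColorings.step hℓ (fun _ _ => preservesColorings_planarMove hℓ) h
    · exact PreservesColorings.step hℓ (fun _ _ => preservesColorings_reidemeisterMove hℓ) h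
    · exact PreservesColorings.step hℓ (fun _ _ => preservesColorings_vMove hℓ hn hQ) h
  | refl => rfl
  | symm _ _ _ ih => exact ih.symm
  | trans _ _ _ _ _ ih ih' => exact ih.trans ih'

end Colorings

/-! ### A quandle with non-commuting actions whose `n`-th powers are trivial. -/

section Heisenberg

/-- Colours of three components. The colours of component 0 are points of an affine space on which
the Heisenberg group modulo `n` acts, those of components 1 and 2 are elements of two conjugacy
classes of this group that do not commute with each other. -/
inductive HeisenbergColor (n : ℕ)
  | point (p w : ZMod n)
  | fst (a : ZMod n)
  | snd (b : ZMod n)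

namespace HeisenbergColor

variable {n : ℕ}

def label : HeisenbergColor n → Fin 3
  | point _ _ => 0
  | fst _ => 1
  | snd _ => 2

/-- Write `X_a` and `Y_b` for the actions of `fst a` and `snd b` on points. The `X_a` commute with
each other, and so do the `Y_b`, while `X_a Y_b X_a⁻¹ = Y_{b+1}` and `Y_b X_a Y_b⁻¹ = X_{a-1}`. The
operation on `fst` and `snd` is this conjugation, which gives self-distributivity; points act
trivially. -/
instance : Quandle (HeisenbergColor n) where
  act
    | fst a, point p w => point (p + 1) (w + a)
    | snd b, point p w => point p (w + b - p)
    | fst _, snd b => snd (b + 1)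
    | snd _, fst a => fst (a - 1)
    | _, y => y
  invAct
    | fst a, point p w => point (p - 1) (w - a)
    | snd b, point p w => point p (w - b + p)
    | fst _, snd b => snd (b - 1)
    | snd _, fst a => fst (a + 1)
    | _, y => y
  self_distrib {x y z} := by
    rcases x <;> rcases y <;> rcases z <;> simp only [point.injEq] <;>
      first | trivial | exact ⟨trivial, by ring⟩
  left_inv x y := by rcases x <;> rcases y <;> simp; ring
  right_inv x y := by rcases x <;> rcases y <;> simp; ring
  fix {x} := by rcases x <;> rfl

theorem isLabelling : IsLabelling (label (n := n)) := by
  intro x y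
  rcases x <;> rcases y <;> rfl

/-- Each action shifts its target by an amount that stays constant under iteration (`snd b` does not
move `p`), so powers are linear in the exponent. No binomial term appears, and even `n` needs no
special care. -/
theorem act'_pow_eq_one (y : HeisenbergColor n) : Rack.act' y ^ n = 1 := by
  have key (k : ℕ) (x : HeisenbergColor n) : (Rack.act' y ^ k) x = match y, x with
      | fst a, point p w => point (p + k) (w + k * a)
      | snd b, point p w => point p (w + k * (b - p))
      | fst _, snd b => snd (b + k)
      | snd _, fst a => fst (a - k)
      | _, x => x := by
    induction k with
    | zero => rcases x <;> rcases y <;> simp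
    | succ k ih =>
      rw [pow_succ', Equiv.Perm.mul_apply, ih, Rack.act'_apply]
      rcases x <;> rcases y <;> simp [Shelf.act] <;> ring_nf
      all_goals trivial
  ext x
  rw [key]
  rcases x <;> rcases y <;> simp

end HeisenbergColor

end Heisenberg

/-! ### Checking by computation that each label forms one circle. -/

section Circles

variable {ι : Type}

/-- The arcs of the diagram within the layer `l` at height `i`. -/
def layerArcs (i : ℕ) (l : Layer ι) : List ((ℕ × ℕ) × (ℕ × ℕ)) :=
  (List.range l.left.length).map (fun j => ((i, j), (i + 1, j))) ++
  (List.range l.right.length).map (fun j => ((i, l.left.length + l.piece.src.length + j),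
    (i + 1, l.left.length + l.piece.tgt.length + j))) ++
  match l.piece with
  | .cross _ _ _ => [((i, l.left.length), (i + 1, l.left.length + 1)),
      ((i, l.left.length + 1), (i + 1, l.left.length))]
  | .cup _ => [((i + 1, l.left.length), (i + 1, l.left.length + 1))]
  | .cap _ => [((i, l.left.length), (i, l.left.length + 1))]

theorem joined_of_mem_layerArcs {w : Word ι} {i : ℕ} {l : Layer ι} (h : w[i]? = some l)
    {e : (ℕ × ℕ) × (ℕ × ℕ)} (he : e ∈ layerArcs i l) : Joined w e.1 e.2 := by
  obtain ⟨A, p, B⟩ := l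
  simp only [layerArcs, List.mem_append, List.mem_map, List.mem_range] at he
  rcases he with (⟨j, hj, rfl⟩ | ⟨j, hj, rfl⟩) | he
  · exact .left h hj
  · exact .right h hj
  · cases p <;> simp only [List.mem_cons, List.not_mem_nil, or_false] at he
    · rcases he with rfl | rfl
      · exact .cross_fst h
      · exact .cross_snd h
    · exact he ▸ .cup h
    · exact he ▸ .cap h

def arcs (w : Word ι) : List ((ℕ × ℕ) × (ℕ × ℕ)) :=
  w.zipIdx.flatMap fun x => layerArcs x.2 x.1

theorem joined_of_mem_arcs {w : Word ι} {e : (ℕ × ℕ) × (ℕ × ℕ)} (he : e ∈ arcs w) :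
    Joined w e.1 e.2 := by
  obtain ⟨x, hx, he⟩ := List.mem_flatMap.1 he
  exact joined_of_mem_layerArcs (List.mem_zipIdx_iff_getElem?.1 hx) he

/-- Points that can be reached from `p` along the given arcs, taken in this order. -/
def reached (E : List ((ℕ × ℕ) × (ℕ × ℕ))) (p : ℕ × ℕ) : List (ℕ × ℕ) :=
  E.foldl (fun S e => if e.1 ∈ S ∨ e.2 ∈ S then e.1 :: e.2 :: S else S) [p]

theorem eqvGen_of_mem_reached {r : ℕ × ℕ → ℕ × ℕ → Prop} {E : List ((ℕ × ℕ) × (ℕ × ℕ))}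
    (hE : ∀ e ∈ E, r e.1 e.2) {p q : ℕ × ℕ} (hq : q ∈ reached E p) : Relation.EqvGen r p q := by
  suffices h : ∀ S : List (ℕ × ℕ), (∀ q ∈ S, Relation.EqvGen r p q) → ∀ q ∈ E.foldl
      (fun S e => if e.1 ∈ S ∨ e.2 ∈ S then e.1 :: e.2 :: S else S) S, Relation.EqvGen r p q from
    h [p] (by simpa using .refl p) q hq
  clear hq q
  induction E with
  | nil => exact fun S hS => hS
  | cons e E ih =>
    intro S hS
    refine ih (fun e he => hE e (.tail _ he)) _ ?_
    have he := Relation.EqvGen.rel _ _ (hE e (.head _))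
    beta_reduce
    split_ifs with h
    · simp only [List.mem_cons]
      rintro q (rfl | rfl | hq)
      · exact h.elim (hS _) fun h => .trans _ _ _ (hS _ h) (.symm _ _ he)
      · exact h.elim (fun h => .trans _ _ _ (hS _ h) he) (hS _)
      · exact hS q hq
    · exact hS

theorem eqvGen_joined_of_hasLabel [DecidableEq ι] {w : Word ι} {c : ι} {p₀ : ℕ × ℕ}
    (h : ∀ i ∈ List.range (w.length + 1), ∀ x ∈ (level w i).zipIdx,
      x.1.label = c → (i, x.2) ∈ reached (arcs w) p₀)
    {p : ℕ × ℕ} (hp : HasLabel w p c) : Relation.EqvGen (Joined w) p₀ p := by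
  obtain ⟨i, j⟩ := p
  obtain ⟨b, hb⟩ := hp
  refine eqvGen_of_mem_reached (fun e => joined_of_mem_arcs) (h i ?_ (⟨b, c⟩, j)
    (List.mem_zipIdx_iff_getElem?.2 hb) rfl)
  rw [List.mem_range]
  by_contra! hi
  obtain ⟨k, rfl⟩ := Nat.exists_eq_add_of_lt hi
  rw [level, List.getElem?_eq_none (Nat.le_add_right w.length k)] at hb
  simp at hb

end Circles

/-! ### Two links that differ by one UC-move. -/

section Closure

/-- The closure of a braid with three strands directed upwards. -/
def closure (w : Word (Fin 3)) : Word (Fin 3) :=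
  [⟨[], .cup ⟨true, 0⟩, []⟩, ⟨[⟨true, 0⟩], .cup ⟨true, 1⟩, [⟨false, 0⟩]⟩,
    ⟨[⟨true, 0⟩, ⟨true, 1⟩], .cup ⟨true, 2⟩, [⟨false, 1⟩, ⟨false, 0⟩]⟩] ++
  whisker [] w [⟨false, 2⟩, ⟨false, 1⟩, ⟨false, 0⟩] ++
  [⟨[⟨true, 0⟩, ⟨true, 1⟩], .cap ⟨true, 2⟩, [⟨false, 1⟩, ⟨false, 0⟩]⟩,
    ⟨[⟨true, 0⟩], .cap ⟨true, 1⟩, [⟨false, 0⟩]⟩, ⟨[], .cap ⟨true, 0⟩, []⟩]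

/-- The strand 0 passes under the strands 1 and 2 and returns to the left of them. -/
def returnBraid : Word (Fin 3) :=
  [⟨[⟨true, 2⟩], .cross .over ⟨true, 1⟩ ⟨true, 0⟩, []⟩,
    ⟨[], .cross .over ⟨true, 2⟩ ⟨true, 0⟩, [⟨true, 1⟩]⟩,
    ⟨[⟨true, 0⟩], .cross .virt ⟨true, 2⟩ ⟨true, 1⟩, []⟩]

/-- Strand 0 passes under 1, 2, 1, 2 in this order, the second time in the opposite direction, so a
commutator acts on its colour. -/
def commutatorWord : Word (Fin 3) :=
  closure (triangleLeft .under .under .virt ⟨true, 0⟩ ⟨true, 1⟩ ⟨true, 2⟩ ++ returnBraid)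

/-- Here strand 0 passes under 2, 1, 1, 2, so R2 and VR2 undo the whole braid. -/
def trivialWord : Word (Fin 3) :=
  closure (triangleRight .under .under .virt ⟨true, 0⟩ ⟨true, 1⟩ ⟨true, 2⟩ ++ returnBraid)

def commutatorLink : LinkDiagram 3 where
  diagram := ⟨commutatorWord, by repeat first | exact rfl | refine ⟨rfl, ?_⟩⟩
  -- The left end of the minimum of component `c`. Each component has a single minimum, so one
  -- upward pass through the arcs from this point reaches the whole component.
  nonempty c := ⟨(c + 1, c), true, by fin_cases c <;> rfl⟩
  connected c p q hp hq := by
    have h : ∀ c : Fin 3, ∀ i ∈ List.range (commutatorWord.length + 1),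
        ∀ x ∈ (level commutatorWord i).zipIdx, x.1.label = c →
          (i, x.2) ∈ reached (arcs commutatorWord) (c + 1, c) := by
      decide +kernel
    exact .trans _ _ _ (.symm _ _ (eqvGen_joined_of_hasLabel (h c) hp))
      (eqvGen_joined_of_hasLabel (h c) hq)

def trivialLink : LinkDiagram 3 where
  diagram := ⟨trivialWord, by repeat first | exact rfl | refine ⟨rfl, ?_⟩⟩
  nonempty c := ⟨(c + 1, c), true, by fin_cases c <;> rfl⟩
  connected c p q hp hq := by
    have h : ∀ c : Fin 3, ∀ i ∈ List.range (trivialWord.length + 1),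
        ∀ x ∈ (level trivialWord i).zipIdx, x.1.label = c →
          (i, x.2) ∈ reached (arcs trivialWord) (c + 1, c) := by
      decide +kernel
    exact .trans _ _ _ (.symm _ _ (eqvGen_joined_of_hasLabel (h c) hp))
      (eqvGen_joined_of_hasLabel (h c) hq)

theorem step_commutatorLink_trivialLink :
    Step UCMove commutatorLink.diagram trivialLink.diagram := by
  exact .mk (hm := .undercrossings _ _ _ .fst ⟨true, 0⟩ ⟨true, 1⟩ ⟨true, 2⟩)
    -- Layers 0 to 2 are the minima of the closure; layers 3 to 5 are the triangle being replaced.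
    (w₁ := commutatorWord.take 3) (w₂ := commutatorWord.drop 6) (L := [])
    (R := [⟨false, 2⟩, ⟨false, 1⟩, ⟨false, 0⟩]) (hD := rfl) (hD' := rfl)

open HeisenbergColor

theorem wordRel_trivialWord (n : ℕ) : WordRel (label (n := n)) trivialWord [] [] := by
  simp [trivialWord, closure, returnBraid, triangleRight, whisker, WordRel, layerRel_cons,
    layerRel_cross, layerRel_cup, layerRel_cap, crossColors, isLabelling.signedAct]
  -- Any colours with the right labels would do, since the actions on the colour of strand 0 cancel
  -- in pairs.
  exact ⟨point 0 0, rfl, fst 0, ⟨rfl, rfl⟩, snd 0, by simp [label, signedAct]⟩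

theorem not_wordRel_commutatorWord {n : ℕ} (hn : n ≠ 1) :
    ¬ WordRel (label (n := n)) commutatorWord [] [] := by
  have key : WordRel (label (n := n)) commutatorWord [] [] ↔
      ∃ x y z : HeisenbergColor n, label x = 0 ∧ label y = 1 ∧ label z = 2 ∧
        signedAct true z (signedAct true y (signedAct false z (signedAct false y x))) = x := by
    simp [commutatorWord, closure, returnBraid, triangleLeft, whisker, WordRel, layerRel_cons,
      layerRel_cross, layerRel_cup, layerRel_cap, crossColors, isLabelling.signedAct]
    grind
  rw [key]
  rintro ⟨x, y, z, hx, hy, hz, h⟩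
  rcases x with ⟨p, w⟩ | _ | _ <;> simp [label] at hx
  rcases y with _ | a | _ <;> simp [label] at hy
  rcases z with _ | _ | b <;> simp [label] at hz
  simp [signedAct, Rack.act'_apply, Shelf.act, Rack.invAct] at h
  -- The commutator fixes `p` and sends `w` to `w - 1`, whatever `a` and `b` are, so `h` amounts to
  -- `-1 = 0`.
  have h₁ : ((1 : ℕ) : ZMod n) = 0 := by
    push_cast
    linear_combination -h
  exact hn (Nat.dvd_one.1 ((ZMod.natCast_eq_zero_iff 1 n).1 h₁))

end Closure

end WeldedLink

theorem corollary5p3 (n : ℕ) (hn : 1 ≤ n) : WeldedLink.UCRealizedByV n ↔ n = 1 := by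
  constructor
  · intro h
    by_contra hne
    have := h 3 _ _ WeldedLink.step_commutatorLink_trivialLink
    exact WeldedLink.not_wordRel_commutatorWord hne
      ((this.wordRel_iff WeldedLink.HeisenbergColor.isLabelling (by omega)
        WeldedLink.HeisenbergColor.act'_pow_eq_one).2 (WeldedLink.wordRel_trivialWord n))
  · rintro rfl
    exact WeldedLink.ucRealizedByV_one
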